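/- **Setting.** Let $M$ be a compact connected finite-dimensional smooth Riemannian manifold (without boundary), with the induced Riemannian distance and balls $B_r(x)$, and let $\mathrm{Leb}$ be a normalised volume on $M$, i.e. a Borel probability measure which in every smooth chart has a smooth, strictly positive density with respect to Lebesgue measure (for instance the normalised Riemannian volume). Let $X$ be a compact metric space, $\theta$ a Borel probability measure on $X$, and $F:M\times X\to M$ a (jointly) measurable map; write $f_\omega(x)=f^x(\omega)=F(x,\omega)$. The pair $((f_\omega)_{\omega\in X},\theta)$ is called a *random perturbation* of $f:M\to M$ if 1. there are $\omega^*\in X$ and $\varepsilon_0>0$ such that $f_{\omega^*}=f$ and $\operatorname{supp}\theta$ contains the ball of radius $\varepsilon_0$ around $\omega^*$; and there is $\rho_0>0$ such that for $\mathrm{Leb}$-a.e. $x\in M$ the perturbed images of $x$ cover $B_{\rho_0}(f(x))$, in the sense that $\operatorname{supp}(f^x_*\theta)\supset B_{\rho_0}(f(x))$ (if $f^x$ is continuous, this holds as soon as $f^x(\operatorname{supp}\theta)\supset B_{\rho_0}(f(x))$); 2. there are constants $\overline q>\underline q>0$ such that for $\mathrm{Leb}$-a.e. $x$ one has $f^x_*\theta=q_x\,\mathrm{Leb}$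 with $\underline q\le q_x\le\overline q$ $\mathrm{Leb}$-a.e. on $\operatorname{supp}(f^x_*\theta)$. For $\underline\omega=(\omega_1,\omega_2,\dots)\in X^{\mathbb N}$ put $f^n_{\underline\omega}=f_{\omega_n}\circ\cdots\circ f_{\omega_1}$ and $f^0_{\underline\omega}=\mathrm{id}$. A Borel probability measure $\mu$ on $M$ is *stationary* if $\int\!\int\varphi\circ f_\omega\,d\mu\,d\theta(\omega)=\int\varphi\,d\mu$ for every $\mu$-integrable $\varphi:M\to\mathbb R$. **Theorem A.** Let $f:M\to M$ be a measurable map that is continuous at $\mathrm{Leb}$-a.e. point, and suppose that there is $x_0\in M$ such that $\{f^n x_0:n\ge1\}$ is dense in $M$ and consists of continuity points of $f$. Then every random perturbation $((f_\omega),\theta)$ of $f$ has exactly one stationary probability measure $\mu$ with $\mu\ll\mathrm{Leb}$, and it has exponential annealed decay of correlations against $L^1$ observables with respect to $\mu\times\theta^{\mathbb N}$: there are $C>0$ and $\lambda>1$ such that for all $n\ge0$ and all non-zero $\phi\in L^\infty(\mathrm{Leb})$, $\psi\in L^1(\mathrm{Leb})$, $$\frac{1}{\|\phi\|_{\infty}\|\psi\|_{1}}\left|\int\Big(\int\psi\circ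 f^n_{\underline\omega}\,d\theta^{\mathbb N}(\underline\omega)\Big)\phi\,d\mu-\int\phi\,d\mu\int\psi\,d\mu\right|\le C\lambda^{-n},$$ where the norms are taken with respect to $\mathrm{Leb}$ and all integrals converge; and the same holds, with the corresponding norms, for $\phi\in L^1(\mathrm{Leb})$ and $\psi\in L^\infty(\mathrm{Leb})$. -/

import Mathlib

open MeasureTheory Set Filter Topology
open scoped ENNReal Manifold ContDiff Bundle

noncomputable section

namespace RandomPert

/-- A normalised (smooth) volume on the `n`-dimensional manifold `M`: a Borel probability measure
which in every smooth chart has a smooth, strictly positive density with respect to Lebesgue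
measure. The normalised Riemannian volume of any Riemannian metric on `M` is of this kind. -/
structure IsNormalizedVolume {n : ℕ} {M : Type*} [TopologicalSpace M] [MeasurableSpace M]
    [ChartedSpace (EuclideanSpace ℝ (Fin n)) M] (Leb : Measure M) : Prop where
  isProbabilityMeasure : IsProbabilityMeasure Leb
  density : ∀ e ∈ IsManifold.maximalAtlas (𝓡 n) ∞ M,
    ∃ r : EuclideanSpace ℝ (Fin n) → ℝ,
      ContDiffOn ℝ ∞ r e.target ∧ (∀ y ∈ e.target, 0 < r y) ∧
      ∀ A : Set M, MeasurableSet A → A ⊆ e.source →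
        Leb A = ∫⁻ y in e '' A, ENNReal.ofReal (r y)

section Perturbation

variable {M X : Type*} [MetricSpace M] [MeasurableSpace M] [MetricSpace X] [MeasurableSpace X]

/-- The pair `(F, θ)`, with `f_w(x) = F x w` and `f^x(w) = F x w`, is a random perturbation of `f`:
* `θ` is a Borel probability measure on `X` whose support contains a ball around the parameter
  `w₀` of the unperturbed map, and `f_{w₀} = f`;
* (covering) for a.e. `x` the perturbed images of `x` under the noise cover the ball of radius
  `ρ₀` around `f x`, in the sense that this ball lies in the support of the law `f^x_* θ`
  of the perturbed image;
* (noise distribution) for a.e. `x` the law `f^x_* θ` has a density `q_x`, and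
  `qlow ≤ q_x ≤ qup` a.e. on its support. -/
structure IsRandomPerturbation (Leb : Measure M) (f : M → M) (F : M → X → M) (θ : Measure X) :
    Prop where
  measurable : Measurable (Function.uncurry F)
  isProbabilityMeasure : IsProbabilityMeasure θ
  unperturbed : ∃ w₀ : X, (∃ ε₀ : ℝ, 0 < ε₀ ∧ Metric.ball w₀ ε₀ ⊆ θ.support) ∧
    ∀ x, F x w₀ = f x
  covering : ∃ ρ₀ : ℝ, 0 < ρ₀ ∧
    ∀ᵐ x ∂Leb, Metric.ball (f x) ρ₀ ⊆ (θ.map (F x)).support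
  noise : ∃ qlow qup : ℝ, 0 < qlow ∧ qlow < qup ∧
    ∀ᵐ x ∂Leb, ∃ q : M → ℝ≥0∞, Measurable q ∧ θ.map (F x) = Leb.withDensity q ∧
      ∀ᵐ y ∂Leb, y ∈ (θ.map (F x)).support →
        ENNReal.ofReal qlow ≤ q y ∧ q y ≤ ENNReal.ofReal qup

/-- If `w ↦ f_w(x)` is continuous, the covering condition follows from the pointwise inclusion
of the ball in the image of the support of the noise. -/
theorem subset_support_map_of_continuous [BorelSpace M] [BorelSpace X] {θ : Measure X}
    {g : X → M} (hg : Continuous g) {B : Set M} (hB : B ⊆ g '' θ.support) :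
    B ⊆ (θ.map g).support := by
  intro y hy
  obtain ⟨w, hw, rfl⟩ := hB hy
  rw [(nhds_basis_opens (g w)).mem_measureSupport]
  rintro U ⟨hU, hUo⟩
  rw [Measure.map_apply hg.measurable hUo.measurableSet]
  exact ((nhds_basis_opens w).mem_measureSupport.1 hw) _ ⟨hU, hUo.preimage hg⟩

/-- The random orbit `f^n_w(x) = f_{w_n} ∘ ⋯ ∘ f_{w_1} (x)`, with the noise sequence indexed
from `0`. -/
def randomOrbit (F : M → X → M) (w : ℕ → X) (x : M) : ℕ → M
  | 0 => x
  | n + 1 => F (randomOrbit F w x n) (w n)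

/-- The law `θ^ℕ` of an i.i.d. noise sequence. -/
def noiseLaw (θ : Measure X) : Measure (ℕ → X) := Measure.infinitePi fun _ => θ

/-- `μ` is stationary: it is a probability measure which is invariant on average over the noise. -/
def IsStationary (F : M → X → M) (θ : Measure X) (μ : Measure M) : Prop :=
  IsProbabilityMeasure μ ∧
    ∀ φ : M → ℝ, Integrable φ μ → ∫ w, (∫ x, φ (F x w) ∂μ) ∂θ = ∫ x, φ x ∂μ

/-- The annealed correlation of `φ ∈ L^p(Leb)` and `ψ ∈ L^q(Leb)` with respect to `μ × θ^ℕ`. -/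
def annealedCor (Leb : Measure M) (F : M → X → M) (θ : Measure X) (μ : Measure M) (p q : ℝ≥0∞)
    (φ ψ : M → ℝ) (n : ℕ) : ℝ :=
  ((eLpNorm φ p Leb).toReal * (eLpNorm ψ q Leb).toReal)⁻¹ *
    |∫ x, (∫ w, ψ (randomOrbit F w x n) ∂(noiseLaw θ)) * φ x ∂μ - (∫ x, φ x ∂μ) * ∫ x, ψ x ∂μ|

/-- Exponential annealed decay of correlations for observables in `L^p(Leb)` against observables
in `L^q(Leb)`: all the integrals in the correlation converge, and the correlations are at most
`C Λ^{-n}` with `C` and `Λ > 1` independent of the observables. -/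
def HasExpDecay (Leb : Measure M) (F : M → X → M) (θ : Measure X) (μ : Measure M)
    (p q : ℝ≥0∞) : Prop :=
  ∃ C Λ : ℝ, 0 < C ∧ 1 < Λ ∧ ∀ φ ψ : M → ℝ, MemLp φ p Leb → MemLp ψ q Leb →
    Integrable φ μ ∧ Integrable ψ μ ∧
    ∀ n : ℕ,
      Integrable (fun z : M × (ℕ → X) => ψ (randomOrbit F z.2 z.1 n) * φ z.1)
        (μ.prod (noiseLaw θ)) ∧
      annealedCor Leb F θ μ p q φ ψ n ≤ C * (Λ ^ n)⁻¹

end Perturbation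

end RandomPert

end

/-!
Averaging over the noise turns the perturbation into a Markov chain whose transition probabilities
charge uniformly the balls of a fixed radius around the unperturbed images. Follow the balls around
the points of the dense orbit of `f`: density makes the chain on these balls irreducible, and
connectedness of `M` makes it aperiodic, so by compactness some power of the transition kernel is
bounded below by a multiple of `Leb` (Doeblin's condition). Each application of such a power
contracts the oscillation of a bounded observable by a fixed factor, which gives uniqueness and
exponential convergence of averages of bounded observables. The upper bound on the noise densities
extends this to integrable observables, since a single step of the noise makes them bounded.
-/

noncomputable section

open ProbabilityTheory
open scoped NNReal

namespace RandomPert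

section Recurrence

variable {α : Type*} {R : ℕ → α → α → Prop}

/-- A family of relations composing like the powers of a transition kernel:
`R k a b` stands for "`b` can be reached from `a` in exactly `k` steps". -/
structure IsTransitionRelation (R : ℕ → α → α → Prop) : Prop where
  zero : ∀ a, R 0 a a
  add : ∀ {j k a b c}, R j a b → R k b c → R (j + k) a c

/-- The period of a state: the greatest common divisor of its return times (`0` if there is no
return at a positive time). -/
def period (R : ℕ → α → α → Prop) (a : α) : ℕ := Nat.setGcd {k | R k a a}

namespace IsTransitionRelation

theorem of_mem_closure (hR : IsTransitionRelation R) {a : α} {k : ℕ}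
    (hk : k ∈ AddSubmonoid.closure {k | R k a a}) : R k a a := by
  induction hk using AddSubmonoid.closure_induction with
  | mem _ hk => exact hk
  | zero => exact hR.zero a
  | add j k _ _ hj hk => exact hR.add hj hk

/-- The phase of a state is the number of steps leading to it from `a`, which is well defined
modulo the period. -/
theorem exists_phase (hR : IsTransitionRelation R) (hirr : ∀ a b, ∃ k, R k a b) (a : α) :
    ∃ p : α → ZMod (period R a), ∀ k b c, R k b c → p c = p b + k := by
  choose out hout using hirr a
  choose back hback using fun b => hirr b a
  have cast_return {k : ℕ} (hk : R k a a) : (k : ZMod (period R a)) = 0 :=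
    (ZMod.natCast_eq_zero_iff _ _).2 (Nat.setGcd_dvd_of_mem hk)
  refine ⟨fun b => out b, fun _ b c hbc => ?_⟩
  have hdirect := cast_return (hR.add (hout c) (hback c))
  have hvia := cast_return (hR.add (hR.add (hout b) hbc) (hback c))
  push_cast at hdirect hvia
  linear_combination hdirect - hvia

theorem exists_forall_ge_return (hR : IsTransitionRelation R) {a : α} (hperiod : period R a = 1) :
    ∃ N, ∀ k, N ≤ k → R k a a := by
  obtain ⟨N, hN⟩ := Nat.exists_mem_closure_of_ge {k | R k a a}
  exact ⟨N, fun k hk => hR.of_mem_closure (hN k hk (by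
    change period R a ∣ k
    rw [hperiod]
    exact one_dvd k))⟩

theorem exists_forall_mem (hR : IsTransitionRelation R) (hirr : ∀ a b, ∃ k, R k a b) {a : α}
    (hperiod : period R a = 1) (s : Finset α) :
    ∃ N, ∀ b ∈ s, ∀ c ∈ s, R N b c := by
  choose out hout using hirr a
  choose back hback using fun b => hirr b a
  obtain ⟨N, hN⟩ := hR.exists_forall_ge_return hperiod
  refine ⟨s.sup back + N + s.sup out, fun b hb c hc => ?_⟩
  have hb_le := Finset.le_sup (f := back) hb
  have hc_le := Finset.le_sup (f := out) hc
  have hloop := hN (s.sup back + N + s.sup out - back b - out c) (by omega)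
  have hpath := hR.add (hback b) (hR.add hloop (hout c))
  rwa [show back b + (s.sup back + N + s.sup out - back b - out c + out c) =
    s.sup back + N + s.sup out by omega] at hpath

end IsTransitionRelation

theorem eq_of_dist_lt_of_denseRange {ι M β : Type*} [PseudoMetricSpace M] [PreconnectedSpace M]
    {v : ι → M} (hv : DenseRange v) {p : ι → β} {r : ℝ} (hr : 0 < r)
    (hp : ∀ i j, dist (v i) (v j) < r → p i = p j) (i j : ι) : p i = p j := by
  choose near hnear using fun x : M => hv.exists_dist_lt x (half_pos (half_pos hr))
  have p_near (x y : M) (hxy : dist y x < r / 2) : p (near y) = p (near x) := hp _ _ <| by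
    have := dist_triangle4 (v (near y)) y x (v (near x))
    have := hnear x
    have := hnear y
    rw [dist_comm] at this
    linarith
  have hlocal : IsLocallyConstant (p ∘ near) :=
    (IsLocallyConstant.iff_eventually_eq _).2 fun x =>
      Filter.mem_of_superset (Metric.ball_mem_nhds x (half_pos hr)) fun y hy => p_near x y hy
  have p_eq_near (i : ι) : p i = p (near (v i)) := hp _ _ ((hnear _).trans (by linarith))
  rw [p_eq_near i, p_eq_near j]
  exact hlocal.apply_eq_of_preconnectedSpace _ _

theorem denseRange_add_left {M : Type*} [TopologicalSpace M] [T1Space M] [PreconnectedSpace M]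
    {u : ℕ → M} (hu : DenseRange u) (N : ℕ) : DenseRange fun n => u (N + n) := by
  rcases subsingleton_or_nontrivial M with hM | hM
  · exact (Function.surjective_to_subsingleton _).denseRange
  have : ConnectedSpace M := { toNonempty := ⟨u 0⟩ }
  refine (hu.sdiff_finite ((finite_Iio N).image u)).mono ?_
  rintro _ ⟨⟨n, rfl⟩, hn⟩
  have hNn : N ≤ n := not_lt.1 fun hlt => hn ⟨n, hlt, rfl⟩
  exact ⟨n - N, congrArg u (Nat.add_sub_cancel' hNn)⟩

/-- The period is `1` because the phase is locally constant along the dense sequence, hence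
constant by connectedness, although it increases by `1` at each step. -/
theorem IsTransitionRelation.exists_forall_mem_of_denseRange {M : Type*} [MetricSpace M]
    [PreconnectedSpace M] {u : ℕ → M} (hu : DenseRange u) {R : ℕ → ℕ → ℕ → Prop}
    (hR : IsTransitionRelation R) {r : ℝ} (hr : 0 < r)
    (hstep : ∀ n m, dist (u (n + 1)) (u m) < r → R 1 n m) (s : Finset ℕ) :
    ∃ N, ∀ b ∈ s, ∀ c ∈ s, R N b c := by
  have hsucc (n : ℕ) : R 1 n (n + 1) := hstep n (n + 1) (by rwa [dist_self])
  have hrun (n k : ℕ) : R k n (n + k) := by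
    induction k with
    | zero => exact hR.zero n
    | succ k ih => exact hR.add ih (hsucc (n + k))
  have hirr (n m : ℕ) : ∃ k, R k n m := by
    obtain ⟨k, hk⟩ := (denseRange_add_left hu (n + 1)).exists_dist_lt (u m) hr
    refine ⟨k + 1, hR.add (hrun n k) (hstep _ _ ?_)⟩
    rwa [dist_comm, Nat.add_right_comm]
  obtain ⟨p, hp⟩ := hR.exists_phase hirr 0
  have hlocal (i j : ℕ) (hij : dist (u i) (u j) < r) : p i = p j := by
    match i, j with
    | 0, 0 => rfl
    | i + 1, j => rw [hp 1 i (i + 1) (hsucc i), hp 1 i j (hstep i j hij)]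
    | 0, j + 1 =>
      rw [hp 1 j (j + 1) (hsucc j), hp 1 j 0 (hstep j 0 (by rwa [dist_comm]))]
  have hone : ((1 : ℕ) : ZMod (period R 0)) = 0 := by
    have hnext := hp 1 0 1 (hsucc 0)
    rwa [eq_of_dist_lt_of_denseRange hu hr hlocal 1 0, left_eq_add] at hnext
  exact hR.exists_forall_mem hirr (Nat.dvd_one.1 ((ZMod.natCast_eq_zero_iff _ _).1 hone)) s

end Recurrence

section Minorization

variable {M : Type*} [MeasurableSpace M]

theorem bind_mono_left {μ ν : Measure M} (h : μ ≤ ν) (κ : Kernel M M) : μ.bind κ ≤ ν.bind κ := by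
  refine Measure.le_iff.2 fun s hs => ?_
  rw [Measure.bind_apply hs κ.aemeasurable, Measure.bind_apply hs κ.aemeasurable]
  exact lintegral_mono' h le_rfl

theorem measure_univ_smul_le_bind {μ ν : Measure M} {κ : Kernel M M} (h : ∀ᵐ x ∂μ, ν ≤ κ x) :
    μ univ • ν ≤ μ.bind κ := by
  refine Measure.le_iff.2 fun s hs => ?_
  rw [Measure.bind_apply hs κ.aemeasurable, Measure.smul_apply, smul_eq_mul, mul_comm,
    ← lintegral_const]
  exact lintegral_mono_ae (h.mono fun x hx => hx s)

theorem bind_le_measure_univ_smul {μ ν : Measure M} {κ : Kernel M M} (h : ∀ᵐ x ∂μ, κ x ≤ ν) :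
    μ.bind κ ≤ μ univ • ν := by
  refine Measure.le_iff.2 fun s hs => ?_
  rw [Measure.bind_apply hs κ.aemeasurable, Measure.smul_apply, smul_eq_mul, mul_comm,
    ← lintegral_const]
  exact lintegral_mono_ae (h.mono fun x hx => hx s)

/-- The measure `ρ` dominates a positive multiple of `ν`, possibly with an infinite factor. -/
def Minorizes (ν ρ : Measure M) : Prop := ∃ c : ℝ≥0∞, c ≠ 0 ∧ c • ν ≤ ρ

namespace Minorizes

variable {ν ν₁ ν₂ ρ τ : Measure M}

theorem of_le (h : ν ≤ ρ) : Minorizes ν ρ := ⟨1, one_ne_zero, by rwa [one_smul]⟩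

theorem trans : Minorizes ν ρ → Minorizes ρ τ → Minorizes ν τ := by
  rintro ⟨c, hc, hνρ⟩ ⟨d, hd, hρτ⟩
  refine ⟨d * c, mul_ne_zero hd hc, ?_⟩
  rw [mul_smul]
  exact (smul_mono_right d hνρ).trans hρτ

theorem bind (h : Minorizes ν ρ) (κ : Kernel M M) : Minorizes (ν.bind κ) (ρ.bind κ) := by
  obtain ⟨c, hc, hνρ⟩ := h
  exact ⟨c, hc, by simpa only [Measure.bind_smul] using bind_mono_left hνρ κ⟩

theorem add (h₁ : Minorizes ν₁ ρ) (h₂ : Minorizes ν₂ ρ) : Minorizes (ν₁ + ν₂) ρ := by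
  obtain ⟨c₁, hc₁, hν₁⟩ := h₁
  obtain ⟨c₂, hc₂, hν₂⟩ := h₂
  refine ⟨2⁻¹ * min c₁ c₂, mul_ne_zero (by simp) (by simp [hc₁, hc₂]), ?_⟩
  calc (2⁻¹ * min c₁ c₂) • (ν₁ + ν₂)
      = (2⁻¹ : ℝ≥0∞) • (min c₁ c₂ • ν₁ + min c₁ c₂ • ν₂) := by rw [mul_smul, smul_add]
    _ ≤ (2⁻¹ : ℝ≥0∞) • (c₁ • ν₁ + c₂ • ν₂) := by
        gcongr
        exacts [min_le_left c₁ c₂, min_le_right c₁ c₂]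
    _ ≤ (2⁻¹ : ℝ≥0∞) • (ρ + ρ) := by gcongr
    _ = ρ := by rw [smul_add, ← add_smul, ENNReal.inv_two_add_inv_two, one_smul]

theorem sum {ι : Type*} {s : Finset ι} {ν : ι → Measure M} (h : ∀ i ∈ s, Minorizes (ν i) ρ) :
    Minorizes (∑ i ∈ s, ν i) ρ :=
  Finset.sum_induction ν (Minorizes · ρ) (fun _ _ => add) (of_le (Measure.zero_le ρ)) h

theorem exists_forall_smul_le {ι : Type*} {s : Finset ι} {ρ : ι → Measure M}
    (h : ∀ i ∈ s, Minorizes ν (ρ i)) : ∃ c : ℝ≥0∞, c ≠ 0 ∧ ∀ i ∈ s, c • ν ≤ ρ i := by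
  choose! c hc hle using h
  refine ⟨s.inf c, pos_iff_ne_zero.1 ?_, fun i hi => ?_⟩
  · exact (Finset.lt_inf_iff ENNReal.zero_lt_top).2 fun i hi => pos_iff_ne_zero.2 (hc i hi)
  · exact (IsOrderedSMul.smul_le_smul_right _ _ (Finset.inf_le hi) ν).trans (hle i hi)

end Minorizes

theorem isTransitionRelation_minorizes {ι : Type*} (B : ι → Measure M) (κ : Kernel M M) :
    IsTransitionRelation fun k i j => Minorizes (B j) ((B i).bind (κ ^ k : Kernel M M)) where
  zero i := .of_le (by rw [pow_zero]; exact Measure.id_comp.ge)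
  add {j k a b c} hab hbc := hbc.trans (by
    rw [add_comm j k, Kernel.pow_add, ← Measure.comp_assoc]
    exact hab.bind _)

variable {m : Measure M}

theorem le_sum_restrict_of_iUnion_eq_univ {ι : Type*} {t : Finset ι} {V : ι → Set M}
    (hV : ⋃ i ∈ t, V i = univ) : m ≤ ∑ i ∈ t, m.restrict (V i) := by
  calc m = m.restrict (⋃ i ∈ t, V i) := by rw [hV, Measure.restrict_univ]
    _ ≤ Measure.sum fun i : t => m.restrict (V i) := by
        rw [← iUnion_subtype (· ∈ t) fun i => V i]
        exact Measure.restrict_iUnion_le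
    _ = ∑ i ∈ t, m.restrict (V i) := Measure.sum_coe_finset t fun i => m.restrict (V i)

section Metric

variable [PseudoMetricSpace M] {ρ : ℝ}

theorem restrict_ball_half_le {y z : M} (h : dist z y < ρ / 2) :
    m.restrict (Metric.ball y (ρ / 2)) ≤ m.restrict (Metric.ball z ρ) :=
  Measure.restrict_mono (Metric.ball_subset_ball' (by rw [dist_comm]; linarith)) le_rfl

theorem minorizes_bind_of_continuousAt [OpensMeasurableSpace M] [m.IsOpenPosMeasure] {f : M → M}
    {κ : Kernel M M} {q : ℝ≥0∞} (hρ : 0 < ρ) (hq : q ≠ 0)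
    (hκ : ∀ᵐ x ∂m, q • m.restrict (Metric.ball (f x) ρ) ≤ κ x) {z : M} (hz : ContinuousAt f z)
    {U : Set M} (hU : U ∈ 𝓝 z) :
    Minorizes (m.restrict (Metric.ball (f z) (ρ / 2))) ((m.restrict U).bind κ) := by
  obtain ⟨V, hVsub, hVopen, hzV⟩ := mem_nhds_iff.1
    (inter_mem hU (hz.preimage_mem_nhds (Metric.ball_mem_nhds (f z) (half_pos hρ))))
  refine ⟨m V * q, mul_ne_zero (hVopen.measure_pos m ⟨z, hzV⟩).ne' hq, ?_⟩
  have hlow : ∀ᵐ x ∂m.restrict V, q • m.restrict (Metric.ball (f z) (ρ / 2)) ≤ κ x := by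
    filter_upwards [ae_restrict_of_ae hκ, ae_restrict_mem hVopen.measurableSet] with x hx hxV
    exact (smul_mono_right q (restrict_ball_half_le (hVsub hxV).2)).trans hx
  calc (m V * q) • m.restrict (Metric.ball (f z) (ρ / 2))
      = m.restrict V univ • q • m.restrict (Metric.ball (f z) (ρ / 2)) := by
        rw [Measure.restrict_apply_univ, mul_smul]
    _ ≤ (m.restrict V).bind κ := measure_univ_smul_le_bind hlow
    _ ≤ (m.restrict U).bind κ :=
        bind_mono_left (Measure.restrict_mono (hVsub.trans inter_subset_left) le_rfl) κ

end Metric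

/-- The transition relation is taken on the balls of radius `ρ / 2` around the orbit points, of
which finitely many cover `M`. -/
theorem exists_minorization [MetricSpace M] [CompactSpace M] [PreconnectedSpace M] [BorelSpace M]
    [m.IsOpenPosMeasure] {f : M → M} {x : M} (hdense : DenseRange fun n => f^[n] x)
    (hcont : ∀ n, ContinuousAt f (f^[n] x)) {κ : Kernel M M} {ρ : ℝ} (hρ : 0 < ρ) {q : ℝ≥0∞}
    (hq : q ≠ 0) (hκ : ∀ᵐ y ∂m, q • m.restrict (Metric.ball (f y) ρ) ≤ κ y) :
    ∃ N, 1 ≤ N ∧ ∃ c : ℝ≥0∞, c ≠ 0 ∧ ∀ᵐ y ∂m, c • m ≤ (κ ^ N) y := by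
  let V (n : ℕ) : Set M := Metric.ball (f^[n + 1] x) (ρ / 2)
  have hstep (i j : ℕ) (hij : dist (f^[i + 1] x) (f^[j] x) < ρ / 2) :
      Minorizes (m.restrict (V j)) ((m.restrict (V i)).bind (κ ^ 1 : Kernel M M)) := by
    simp only [V, pow_one, Function.iterate_succ_apply' f j]
    exact minorizes_bind_of_continuousAt hρ hq hκ (hcont j)
      (Metric.isOpen_ball.mem_nhds (by rwa [dist_comm] at hij))
  have hcover : ⋃ n, V n = univ := eq_univ_of_forall fun z => by
    obtain ⟨n, hn⟩ := (denseRange_add_left hdense 1).exists_dist_lt z (half_pos hρ)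
    exact mem_iUnion.2 ⟨n, by rwa [Metric.mem_ball, add_comm]⟩
  obtain ⟨t, ht⟩ := isCompact_univ.elim_finite_subcover V (fun _ => Metric.isOpen_ball) hcover.ge
  obtain ⟨N, hN⟩ := (isTransitionRelation_minorizes (fun n => m.restrict (V n))
    κ).exists_forall_mem_of_denseRange hdense (half_pos hρ) hstep t
  obtain ⟨c, hc, hcN⟩ := Minorizes.exists_forall_smul_le fun i hi =>
    (Minorizes.of_le (le_sum_restrict_of_iUnion_eq_univ (univ_subset_iff.1 ht))).trans
      (.sum fun j hj => hN i hi j hj)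
  refine ⟨N + 1, N.succ_pos, q * c, mul_ne_zero hq hc, hκ.mono fun y hy => ?_⟩
  obtain ⟨i, hi, hyi⟩ := mem_iUnion₂.1 (ht (mem_univ (f y)))
  calc (q * c) • m = q • c • m := mul_smul q c m
    _ ≤ q • (m.restrict (V i)).bind (κ ^ N : Kernel M M) := smul_mono_right q (hcN i hi)
    _ = (q • m.restrict (V i)).bind (κ ^ N : Kernel M M) := (Measure.bind_smul _ _ _).symm
    _ ≤ (κ y).bind (κ ^ N : Kernel M M) :=
        bind_mono_left ((smul_mono_right q (restrict_ball_half_le hyi)).trans hy) _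
    _ = (κ ^ (N + 1)) y := by rw [Kernel.pow_add, pow_one, Kernel.comp_apply]

end Minorization

section Ergodicity

variable {M : Type*} [MeasurableSpace M] {m μ ν : Measure M} {P κ : Kernel M M} {c : ℝ≥0}
  {g : M → ℝ} {a b : ℝ}

instance isMarkovKernel_pow [IsMarkovKernel κ] (n : ℕ) : IsMarkovKernel (κ ^ n) := by
  induction n with
  | zero => rw [pow_zero]; exact inferInstanceAs (IsMarkovKernel Kernel.id)
  | succ n ih => rw [add_comm, Kernel.pow_add, pow_one]; infer_instance

theorem bind_pow_add (κ : Kernel M M) (μ : Measure M) (j k : ℕ) :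
    μ.bind (κ ^ (j + k) : Kernel M M) =
      (μ.bind (κ ^ j : Kernel M M)).bind (κ ^ k : Kernel M M) := by
  rw [Measure.comp_assoc, add_comm, Kernel.pow_add]

theorem bind_pow_absolutelyContinuous (hκ : m.bind κ ≪ m) (n : ℕ) :
    m.bind (κ ^ n : Kernel M M) ≪ m := by
  induction n with
  | zero => rw [pow_zero]; exact Measure.absolutelyContinuous_of_eq Measure.id_comp
  | succ n ih => rw [bind_pow_add, pow_one]; exact (ih.comp_right κ).trans hκ

theorem invariant_pow (hμ : κ.Invariant μ) (n : ℕ) : (κ ^ n).Invariant μ := by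
  induction n with
  | zero => rw [pow_zero]; exact Measure.id_comp
  | succ n ih => rw [Kernel.pow_add, pow_one]; exact ih.comp hμ

theorem integral_bind (hg : Integrable g (μ.bind κ)) :
    ∫ y, g y ∂(μ.bind κ) = ∫ x, ∫ y, g y ∂(κ x) ∂μ := by
  rw [Measure.comp_eq_comp_const_apply] at hg ⊢
  rw [Kernel.integral_comp hg, Kernel.const_apply]

theorem integrable_integral_of_bind (hg : Integrable g (μ.bind κ)) :
    Integrable (fun x => ∫ y, g y ∂(κ x)) μ := by
  rw [Measure.comp_eq_comp_const_apply] at hg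
  simpa only [Kernel.const_apply] using hg.integral_comp

theorem ae_integral_pow_add (j k : ℕ) (hg : Integrable g (μ.bind (κ ^ (j + k) : Kernel M M))) :
    ∀ᵐ x ∂μ, ∫ y, g y ∂((κ ^ (j + k)) x) = ∫ z, ∫ y, g y ∂((κ ^ k) z) ∂((κ ^ j) x) := by
  filter_upwards [Measure.ae_integrable_of_integrable_comp hg] with x hx
  rw [add_comm, Kernel.pow_add] at hx ⊢
  exact Kernel.integral_comp hx

theorem integrable_of_absolutelyContinuous [IsFiniteMeasure ν] (hν : ν ≪ m)
    (hg : AEMeasurable g m) (hgab : ∀ᵐ x ∂m, g x ∈ Icc a b) : Integrable g ν :=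
  .of_mem_Icc a b (hg.mono_ac hν) (hν.ae_le hgab)

theorem integral_mem_Icc [IsProbabilityMeasure ν] (hg : Integrable g ν)
    (hgab : ∀ᵐ x ∂ν, g x ∈ Icc a b) : ∫ x, g x ∂ν ∈ Icc a b := by
  constructor
  · simpa using integral_mono_ae (integrable_const a) hg (hgab.mono fun _ h => h.1)
  · simpa using integral_mono_ae hg (integrable_const b) (hgab.mono fun _ h => h.2)

theorem ae_integral_mem_Icc [IsFiniteMeasure m] [IsMarkovKernel κ] (hκ : m.bind κ ≪ m)
    (hg : AEMeasurable g m) (hgab : ∀ᵐ x ∂m, g x ∈ Icc a b) :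
    ∀ᵐ x ∂m, ∫ y, g y ∂(κ x) ∈ Icc a b := by
  filter_upwards [Measure.ae_ae_of_ae_comp (hκ.ae_le hgab), Measure.ae_integrable_of_integrable_comp
    (integrable_of_absolutelyContinuous hκ hg hgab)] with x hx hgx
  exact integral_mem_Icc hgx hx

theorem le_integral_of_smul_le [IsProbabilityMeasure m] [IsProbabilityMeasure ν]
    (hν : c • m ≤ ν) (hgm : Integrable g m) (hgν : Integrable g ν) (hga : ∀ᵐ x ∂ν, a ≤ g x) :
    (1 - c) * a + c * ∫ x, g x ∂m ≤ ∫ x, g x ∂ν := by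
  have h := integral_mono_measure hν (f := fun x => g x - a)
    (hga.mono fun x hx => sub_nonneg.2 hx) (hgν.sub (integrable_const a))
  rw [integral_smul_nnreal_measure, integral_sub hgm (integrable_const a),
    integral_sub hgν (integrable_const a)] at h
  simp only [integral_const, probReal_univ, NNReal.smul_def, smul_eq_mul] at h
  linarith

theorem integral_le_of_smul_le [IsProbabilityMeasure m] [IsProbabilityMeasure ν]
    (hν : c • m ≤ ν) (hgm : Integrable g m) (hgν : Integrable g ν) (hgb : ∀ᵐ x ∂ν, g x ≤ b) :
    ∫ x, g x ∂ν ≤ (1 - c) * b + c * ∫ x, g x ∂m := by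
  have h := le_integral_of_smul_le hν hgm.neg hgν.neg (a := -b)
    (hgb.mono fun x hx => neg_le_neg hx)
  simp only [Pi.neg_apply, integral_neg] at h
  linarith

/-- Doeblin's condition for the kernel `P` relative to the measure `m`: up to null sets, `P`
preserves absolute continuity and all its transition probabilities dominate `c • m`. -/
structure IsDoeblin (m : Measure M) (c : ℝ≥0) (P : Kernel M M) : Prop where
  bind_absolutelyContinuous : m.bind P ≪ m
  smul_le : ∀ᵐ x ∂m, c • m ≤ P x

namespace IsDoeblin

variable [IsProbabilityMeasure m] [IsMarkovKernel P]

theorem le_one (h : IsDoeblin m c P) : c ≤ 1 := by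
  obtain ⟨x, hx⟩ := h.smul_le.exists
  simpa using hx univ

theorem integral_mem_Icc (h : IsDoeblin m c P) (hg : AEMeasurable g m)
    (hgab : ∀ᵐ x ∂m, g x ∈ Icc a b) :
    ∀ᵐ x ∂m, ∫ y, g y ∂(P x) ∈
      Icc ((1 - c) * a + c * ∫ y, g y ∂m) ((1 - c) * b + c * ∫ y, g y ∂m) := by
  have hgm := integrable_of_absolutelyContinuous .rfl hg hgab
  have hgP := integrable_of_absolutelyContinuous h.bind_absolutelyContinuous hg hgab
  filter_upwards [h.smul_le, Measure.ae_integrable_of_integrable_comp hgP,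
    Measure.ae_ae_of_ae_comp (h.bind_absolutelyContinuous.ae_le hgab)] with x hx hgx hgabx
  exact ⟨le_integral_of_smul_le hx hgm hgx (hgabx.mono fun y hy => hy.1),
    integral_le_of_smul_le hx hgm hgx (hgabx.mono fun y hy => hy.2)⟩

theorem exists_integral_pow_mem_Icc (h : IsDoeblin m c P) (hg : AEMeasurable g m)
    (hgab : ∀ᵐ x ∂m, g x ∈ Icc a b) (k : ℕ) :
    ∃ a' b', b' - a' = (1 - c) ^ k * (b - a) ∧
      ∀ᵐ x ∂m, ∫ y, g y ∂((P ^ k) x) ∈ Icc a' b' := by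
  have hac (j : ℕ) : m.bind (P ^ j : Kernel M M) ≪ m :=
    bind_pow_absolutelyContinuous h.bind_absolutelyContinuous j
  have hint (j : ℕ) : Integrable g (m.bind (P ^ j : Kernel M M)) :=
    integrable_of_absolutelyContinuous (hac j) hg hgab
  induction k with
  | zero => exact ⟨a, b, by ring, ae_integral_mem_Icc (hac 0) hg hgab⟩
  | succ k ih =>
    obtain ⟨a', b', hab, hk⟩ := ih
    rw [add_comm k 1]
    refine ⟨(1 - c) * a' + c * ∫ x, ∫ y, g y ∂((P ^ k) x) ∂m,
      (1 - c) * b' + c * ∫ x, ∫ y, g y ∂((P ^ k) x) ∂m, ?_, ?_⟩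
    · rw [pow_add, pow_one]
      linear_combination (1 - (c : ℝ)) * hab
    · filter_upwards [h.integral_mem_Icc (integrable_integral_of_bind (hint k)).aemeasurable hk,
        ae_integral_pow_add 1 k (hint (1 + k))] with x hx hxk
      rwa [hxk, pow_one]

/-- Since `μ` is invariant, the averages of `g` along `P ^ k` have the `μ`-mean of `g` as their
mean. -/
theorem abs_integral_pow_sub_le (h : IsDoeblin m c P) [IsProbabilityMeasure μ]
    (hμ : P.Invariant μ) (hμm : μ ≪ m) (hg : AEMeasurable g m) (hgab : ∀ᵐ x ∂m, g x ∈ Icc a b)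
    (k : ℕ) :
    ∀ᵐ x ∂m, |∫ y, g y ∂((P ^ k) x) - ∫ y, g y ∂μ| ≤ (1 - c) ^ k * (b - a) := by
  obtain ⟨a', b', hab, hk⟩ := h.exists_integral_pow_mem_Icc hg hgab k
  have hgμ : Integrable g (μ.bind (P ^ k : Kernel M M)) := by
    rw [(invariant_pow hμ k).def]
    exact integrable_of_absolutelyContinuous hμm hg hgab
  have hmean := RandomPert.integral_mem_Icc (integrable_integral_of_bind hgμ) (hμm.ae_le hk)
  rw [← integral_bind hgμ, (invariant_pow hμ k).def] at hmean
  filter_upwards [hk] with x hx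
  rw [← hab]
  exact abs_sub_le_of_le_of_le hx.1 hx.2 hmean.1 hmean.2

theorem eq_of_invariant (h : IsDoeblin m c P) (hc : 0 < c) [IsProbabilityMeasure μ]
    [IsProbabilityMeasure ν] (hμ : P.Invariant μ) (hμm : μ ≪ m) (hν : P.Invariant ν)
    (hνm : ν ≪ m) : μ = ν := by
  ext s hs
  have hind : ∀ᵐ x ∂m, s.indicator (1 : M → ℝ) x ∈ Icc 0 1 := .of_forall fun x =>
    ⟨indicator_nonneg (fun _ _ => zero_le_one) x, indicator_le_self' (fun _ _ => zero_le_one) x⟩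
  have hmeas : AEMeasurable (s.indicator (1 : M → ℝ)) m :=
    (measurable_one.indicator hs).aemeasurable
  have hdist (k : ℕ) : |μ.real s - ν.real s| ≤ 2 * (1 - c) ^ k := by
    obtain ⟨x, hxμ, hxν⟩ := ((h.abs_integral_pow_sub_le hμ hμm hmeas hind k).and
      (h.abs_integral_pow_sub_le hν hνm hmeas hind k)).exists
    rw [integral_indicator_one hs, integral_indicator_one hs] at hxμ hxν
    rw [abs_sub_comm] at hxμ
    linarith [abs_sub_le (μ.real s) (((P ^ k) x).real s) (ν.real s)]
  have hc1 : (c : ℝ) ≤ 1 := mod_cast h.le_one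
  have hc0 : (0 : ℝ) < c := mod_cast hc
  have hlim := (tendsto_pow_atTop_nhds_zero_of_lt_one (sub_nonneg.2 hc1)
    (sub_lt_self 1 hc0)).const_mul 2
  rw [mul_zero] at hlim
  exact (measureReal_eq_measureReal_iff).1
    (sub_eq_zero.1 (abs_nonpos_iff.1 (ge_of_tendsto' hlim hdist)))

end IsDoeblin

/-- For a kernel `P ≥ c • m`, the part of `ν.bind P` which remains after its guaranteed multiple of
`m` is removed. -/
def remainder (m : Measure M) (c : ℝ≥0) (P : Kernel M M) (ν : Measure M) : Measure M :=
  ν.bind P - (c * ν univ) • m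

theorem isFiniteMeasure_iterate_remainder (m : Measure M) [IsFiniteMeasure m] (c : ℝ≥0)
    (P : Kernel M M) [IsFiniteKernel P] (k : ℕ) : IsFiniteMeasure ((remainder m c P)^[k] m) := by
  induction k with
  | zero => assumption
  | succ k ih =>
    rw [Function.iterate_succ_apply']
    exact inferInstanceAs (IsFiniteMeasure (_ - _))

namespace IsDoeblin

theorem remainder_add [IsFiniteMeasure m] (h : IsDoeblin m c P) [IsFiniteMeasure ν] (hν : ν ≪ m) :
    remainder m c P ν + (c * ν univ) • m = ν.bind P := by
  have := m.smul_finite (ENNReal.mul_ne_top (ENNReal.coe_ne_top (r := c)) (measure_ne_top ν univ))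
  refine Measure.sub_add_cancel_of_le ?_
  rw [mul_comm, mul_smul]
  exact measure_univ_smul_le_bind (hν.ae_le h.smul_le)

theorem remainder_absolutelyContinuous (h : IsDoeblin m c P) (hν : ν ≪ m) :
    remainder m c P ν ≪ m :=
  (Measure.absolutelyContinuous_of_le Measure.sub_le).trans
    ((hν.comp_right P).trans h.bind_absolutelyContinuous)

variable [IsProbabilityMeasure m] [IsMarkovKernel P]

theorem remainder_univ (h : IsDoeblin m c P) [IsFiniteMeasure ν] (hν : ν ≪ m) :
    remainder m c P ν univ = (1 - c) * ν univ := by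
  have hfin : c * ν univ ≠ ⊤ := ENNReal.mul_ne_top ENNReal.coe_ne_top (measure_ne_top ν univ)
  have hmass : remainder m c P ν univ + c * ν univ = ν univ := by
    simpa using congrArg (· univ) (h.remainder_add hν)
  rw [ENNReal.eq_sub_of_add_eq hfin hmass, ENNReal.sub_mul fun _ _ => measure_ne_top ν univ,
    one_mul]

theorem iterate_remainder (h : IsDoeblin m c P) (k : ℕ) :
    (remainder m c P)^[k] m ≪ m ∧ (remainder m c P)^[k] m univ = (1 - c) ^ k := by
  induction k with
  | zero => simp [Measure.AbsolutelyContinuous.rfl]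
  | succ k ih =>
    have := isFiniteMeasure_iterate_remainder m c P k
    rw [Function.iterate_succ_apply']
    exact ⟨h.remainder_absolutelyContinuous ih.1, by rw [h.remainder_univ ih.1, ih.2, pow_succ']⟩

theorem tsum_mul_one_sub_pow (h : IsDoeblin m c P) (hc : 0 < c) :
    ∑' k : ℕ, (c : ℝ≥0∞) * (1 - c) ^ k = 1 := by
  rw [ENNReal.tsum_mul_left, ENNReal.tsum_geometric, ENNReal.sub_sub_cancel ENNReal.one_ne_top
    (mod_cast h.le_one), ENNReal.mul_inv_cancel (mod_cast hc.ne') ENNReal.coe_ne_top]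

/-- The invariant measure is `∑ c • m (P - c m)^k`: starting from `m`, the chain is restarted
from `m` with probability `c` at each step. -/
theorem exists_invariant (h : IsDoeblin m c P) (hc : 0 < c) :
    ∃ μ : Measure M, IsProbabilityMeasure μ ∧ μ ≪ m ∧ P.Invariant μ := by
  let ν (k : ℕ) : Measure M := (remainder m c P)^[k] m
  have hstep (k : ℕ) : ν (k + 1) + (c * (1 - c) ^ k : ℝ≥0∞) • m = (ν k).bind P := by
    have := isFiniteMeasure_iterate_remainder m c P k
    rw [← (h.iterate_remainder k).2, ← h.remainder_add (h.iterate_remainder k).1]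
    simp only [ν, Function.iterate_succ_apply']
  refine ⟨(c : ℝ≥0∞) • Measure.sum ν, ⟨?_⟩, ?_, ?_⟩
  · rw [Measure.smul_apply, Measure.sum_apply _ .univ, smul_eq_mul, ← ENNReal.tsum_mul_left,
      ← h.tsum_mul_one_sub_pow hc]
    exact tsum_congr fun k => by rw [(h.iterate_remainder k).2]
  · exact Measure.smul_absolutelyContinuous.trans
      (Measure.absolutelyContinuous_sum_left fun k => (h.iterate_remainder k).1)
  · have hsum : Measure.sum ν = m + Measure.sum fun k => ν (k + 1) := by
      ext s hs
      simp only [Measure.add_apply, Measure.sum_apply _ hs]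
      exact tsum_eq_zero_add' ENNReal.summable
    have hrestart : (Measure.sum fun k : ℕ => (c * (1 - c) ^ k : ℝ≥0∞) • m) = m := by
      ext s hs
      simp only [Measure.sum_apply _ hs, Measure.smul_apply, smul_eq_mul]
      rw [ENNReal.tsum_mul_right, h.tsum_mul_one_sub_pow hc, one_mul]
    have hbind : (Measure.sum ν).bind P = Measure.sum ν := by
      rw [Measure.bind_sum _ _ P.aemeasurable, ← funext hstep, ← Measure.sum_add_sum, hrestart,
        add_comm, ← hsum]
    rw [Kernel.Invariant, Measure.bind_smul, hbind]

end IsDoeblin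

/-- Uniform ergodicity of `κ` with stationary law `μ`: averages of bounded observables converge to
their `μ`-mean geometrically, uniformly up to `m`-null sets. -/
def IsUniformlyErgodic (m : Measure M) (κ : Kernel M M) (μ : Measure M) (A Λ : ℝ) : Prop :=
  ∀ ⦃g : M → ℝ⦄ ⦃B : ℝ⦄, AEMeasurable g m → (∀ᵐ x ∂m, |g x| ≤ B) → ∀ n : ℕ,
    ∀ᵐ x ∂m, |∫ y, g y ∂((κ ^ n) x) - ∫ y, g y ∂μ| ≤ A * B * (Λ ^ n)⁻¹

theorem exists_pow_div_le {s : ℝ} (hs : 0 < s) (hs1 : s < 1) {N : ℕ} (hN : 1 ≤ N) :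
    ∃ Λ : ℝ, 1 < Λ ∧ ∀ n : ℕ, s ^ (n / N) ≤ s⁻¹ * (Λ ^ n)⁻¹ := by
  obtain ⟨u, hu0, huN⟩ : ∃ u : ℝ, 0 < u ∧ u ^ N = s :=
    ⟨s ^ (N⁻¹ : ℝ), Real.rpow_pos_of_pos hs _, Real.rpow_inv_natCast_pow hs.le (by omega)⟩
  have hu1 : u < 1 := (pow_lt_one_iff_of_nonneg hu0.le (by omega)).1 (huN ▸ hs1)
  refine ⟨u⁻¹, (one_lt_inv₀ hu0).2 hu1, fun n => ?_⟩
  have hn : n ≤ N * (n / N + 1) := (Nat.lt_mul_div_succ n hN).le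
  rw [inv_pow, inv_inv, inv_mul_eq_div, le_div_iff₀ hs]
  calc s ^ (n / N) * s = u ^ (N * (n / N + 1)) := by rw [pow_mul, huN, pow_succ]
    _ ≤ u ^ n := pow_le_pow_of_le_one hu0.le hu1.le hn

section Power

variable [IsProbabilityMeasure m] [IsMarkovKernel κ] {N : ℕ}

theorem exists_invariant_of_isDoeblin_pow (hκ : m.bind κ ≪ m) (h : IsDoeblin m c (κ ^ N))
    (hc : 0 < c) : ∃ μ : Measure M, IsProbabilityMeasure μ ∧ μ ≪ m ∧ κ.Invariant μ := by
  obtain ⟨μ, hμp, hμm, hμ⟩ := h.exists_invariant hc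
  have hμκ : (κ ^ N).Invariant (μ.bind κ) := by
    rw [Kernel.Invariant, ← pow_one κ, ← pow_mul, one_mul, ← bind_pow_add, add_comm, bind_pow_add,
      hμ.def]
  exact ⟨μ, hμp, hμm, h.eq_of_invariant hc hμκ ((hμm.comp_right κ).trans hκ) hμ hμm⟩

theorem abs_integral_sub_le_of_isDoeblin_pow (hκ : m.bind κ ≪ m) (h : IsDoeblin m c (κ ^ N))
    [IsProbabilityMeasure μ] (hμ : κ.Invariant μ) (hμm : μ ≪ m) (hg : AEMeasurable g m)
    (hgab : ∀ᵐ x ∂m, g x ∈ Icc a b) (n : ℕ) :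
    ∀ᵐ x ∂m, |∫ y, g y ∂((κ ^ n) x) - ∫ y, g y ∂μ| ≤ (1 - c) ^ (n / N) * (b - a) := by
  have hac (j : ℕ) := bind_pow_absolutelyContinuous hκ j
  have hint (j : ℕ) := integrable_of_absolutelyContinuous (hac j) hg hgab
  have hmean : ∫ x, ∫ y, g y ∂((κ ^ (n % N)) x) ∂μ = ∫ y, g y ∂μ := by
    rw [← integral_bind, (invariant_pow hμ (n % N)).def]
    rw [(invariant_pow hμ (n % N)).def]
    exact integrable_of_absolutelyContinuous hμm hg hgab
  have hn : N * (n / N) + n % N = n := Nat.div_add_mod n N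
  filter_upwards [h.abs_integral_pow_sub_le (invariant_pow hμ N) hμm
    (integrable_integral_of_bind (hint (n % N))).aemeasurable
    (ae_integral_mem_Icc (hac (n % N)) hg hgab) (n / N),
    ae_integral_pow_add (N * (n / N)) (n % N) (by rw [hn]; exact hint n)] with x hx hxn
  rw [hn, pow_mul] at hxn
  rwa [hxn, ← hmean]

theorem exists_isUniformlyErgodic (hκ : m.bind κ ≪ m) (hN : 1 ≤ N) (h : IsDoeblin m c (κ ^ N))
    (hc : 0 < c) (hc1 : c < 1) [IsProbabilityMeasure μ] (hμ : κ.Invariant μ) (hμm : μ ≪ m) :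
    ∃ A Λ : ℝ, 0 < A ∧ 1 < Λ ∧ IsUniformlyErgodic m κ μ A Λ := by
  have hs : (0 : ℝ) < 1 - c := sub_pos.2 (mod_cast hc1)
  obtain ⟨Λ, hΛ, hrate⟩ := exists_pow_div_le hs (sub_lt_self 1 (mod_cast hc)) hN
  refine ⟨2 * (1 - c : ℝ)⁻¹, Λ, by positivity, hΛ, fun g B hg hB n => ?_⟩
  obtain ⟨x, hx⟩ := hB.exists
  have hB0 : 0 ≤ B := (abs_nonneg _).trans hx
  filter_upwards [abs_integral_sub_le_of_isDoeblin_pow hκ h hμ hμm hg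
    (hB.mono fun x hx => abs_le.1 hx) n] with x hx
  calc |∫ y, g y ∂((κ ^ n) x) - ∫ y, g y ∂μ| ≤ (1 - c) ^ (n / N) * (B - -B) := hx
    _ ≤ ((1 - c : ℝ)⁻¹ * (Λ ^ n)⁻¹) * (B - -B) := by
      gcongr
      · linarith
      · exact hrate n
    _ = 2 * (1 - c : ℝ)⁻¹ * B * (Λ ^ n)⁻¹ := by ring

end Power

theorem exists_isDoeblin_pow [MetricSpace M] [CompactSpace M] [PreconnectedSpace M] [BorelSpace M]
    [m.IsOpenPosMeasure] {f : M → M} {x : M} (hdense : DenseRange fun n => f^[n] x)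
    (hcont : ∀ n, ContinuousAt f (f^[n] x)) {ρ : ℝ} (hρ : 0 < ρ) {q : ℝ≥0∞} (hq : q ≠ 0)
    (hκ : ∀ᵐ y ∂m, q • m.restrict (Metric.ball (f y) ρ) ≤ κ y) (hac : m.bind κ ≪ m) :
    ∃ N, 1 ≤ N ∧ ∃ c : ℝ≥0, 0 < c ∧ c < 1 ∧ IsDoeblin m c (κ ^ N) := by
  obtain ⟨N, hN, c', hc', hmin⟩ := exists_minorization hdense hcont hρ hq hκ
  obtain ⟨c, hc, hcc'⟩ := ENNReal.lt_iff_exists_nnreal_btwn.1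
    (lt_min (pos_iff_ne_zero.2 hc') zero_lt_one)
  refine ⟨N, hN, c, mod_cast hc, mod_cast hcc'.trans_le (min_le_right _ _),
    bind_pow_absolutelyContinuous hac N, hmin.mono fun y hy => le_trans ?_ hy⟩
  exact IsOrderedSMul.smul_le_smul_right _ _ (hcc'.le.trans (min_le_left _ _)) m

end Ergodicity

section Transition

variable {M X : Type*} [MeasurableSpace M] [MeasurableSpace X] {F : M → X → M} {θ : Measure X}
  [IsProbabilityMeasure θ] {μ : Measure M}

/-- The transition kernel `x ↦ f^x_* θ` of the random perturbation. -/
def transition (F : M → X → M) (θ : Measure X) [SFinite θ]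
    (hF : Measurable (Function.uncurry F)) : Kernel M M where
  toFun x := θ.map (F x)
  measurable' := by
    refine Measure.measurable_of_measurable_coe _ fun s hs => ?_
    simp only [Measure.map_apply (hF.of_uncurry_left) hs]
    exact measurable_measure_prodMk_left (hF hs)

instance isMarkovKernel_transition (hF : Measurable (Function.uncurry F)) :
    IsMarkovKernel (transition F θ hF) :=
  ⟨fun _ => Measure.isProbabilityMeasure_map hF.of_uncurry_left.aemeasurable⟩

theorem map_prod_eq_bind {Y Z : Type*} [MeasurableSpace Y] [MeasurableSpace Z]
    {G : M × Y → Z} (hG : Measurable G) {η : Measure Y} [SFinite η] {κ : Kernel M Z}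
    (hκ : ∀ x, η.map (fun y => G (x, y)) = κ x) : (μ.prod η).map G = μ.bind κ := by
  ext s hs
  rw [Measure.map_apply hG hs, Measure.prod_apply (hG hs), Measure.bind_apply hs κ.aemeasurable]
  refine lintegral_congr fun x => ?_
  rw [← hκ]
  exact (Measure.map_apply (hG.comp measurable_prodMk_left) hs).symm

theorem map_prod_eq_bind_transition (hF : Measurable (Function.uncurry F)) [SFinite μ] :
    (μ.prod θ).map (Function.uncurry F) = μ.bind (transition F θ hF) :=
  map_prod_eq_bind hF fun _ => rfl

theorem integral_integral_perturbation (hF : Measurable (Function.uncurry F)) [SFinite μ]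
    {φ : M → ℝ} (hφ : Integrable φ (μ.bind (transition F θ hF))) :
    ∫ w, ∫ x, φ (F x w) ∂μ ∂θ = ∫ x, φ x ∂(μ.bind (transition F θ hF)) := by
  rw [← map_prod_eq_bind_transition] at hφ ⊢
  have hint : Integrable (Function.uncurry fun x w => φ (F x w)) (μ.prod θ) :=
    hφ.comp_measurable hF
  rw [← integral_integral_swap hint, integral_integral hint,
    integral_map hF.aemeasurable hφ.aestronglyMeasurable]
  rfl

theorem isStationary_iff (hF : Measurable (Function.uncurry F)) :
    IsStationary F θ μ ↔ IsProbabilityMeasure μ ∧ (transition F θ hF).Invariant μ := by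
  refine and_congr_right fun _ => ⟨fun h => ?_, fun h φ hφ => ?_⟩
  · ext s hs
    have hone {ν : Measure M} [IsFiniteMeasure ν] : Integrable (s.indicator (1 : M → ℝ)) ν :=
      (integrable_const 1).indicator hs
    have hs1 := h _ hone
    rw [integral_integral_perturbation hF hone, integral_indicator_one hs,
      integral_indicator_one hs] at hs1
    exact (measureReal_eq_measureReal_iff).1 hs1
  · rw [integral_integral_perturbation hF (by rwa [h.def]), h.def]

end Transition

section Orbit

variable {M X : Type*} [MeasurableSpace M] [MeasurableSpace X] {F : M → X → M} {θ : Measure X}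
  [IsProbabilityMeasure θ]

instance isProbabilityMeasure_noiseLaw : IsProbabilityMeasure (noiseLaw θ) :=
  inferInstanceAs (IsProbabilityMeasure (Measure.infinitePi fun _ => θ))

theorem measurable_randomOrbit (hF : Measurable (Function.uncurry F)) (n : ℕ) :
    Measurable fun z : M × (ℕ → X) => randomOrbit F z.2 z.1 n := by
  induction n with
  | zero => exact measurable_fst
  | succ n ih => exact hF.comp (ih.prodMk ((measurable_pi_apply n).comp measurable_snd))

/-- The σ-algebra on noise sequences generated by the noise before time `n`. -/
abbrev pastNoise (X : Type*) [MeasurableSpace X] (n : ℕ) : MeasurableSpace (ℕ → X) :=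
  ⨆ i ∈ Iio n, MeasurableSpace.comap (fun w => w i) inferInstance

theorem measurable_pastNoise_randomOrbit (hF : Measurable (Function.uncurry F)) (x : M) (n : ℕ) :
    Measurable[pastNoise X n] fun w : ℕ → X => randomOrbit F w x n := by
  induction n with
  | zero => exact measurable_const
  | succ n ih =>
    have hle : pastNoise X n ≤ pastNoise X (n + 1) :=
      biSup_mono fun i (hi : i < n) => (hi.trans n.lt_succ_self : i < n + 1)
    have hn : Measurable[pastNoise X (n + 1)] fun w : ℕ → X => w n :=
      (comap_measurable _).mono
        (le_biSup (fun i => MeasurableSpace.comap (fun w : ℕ → X => w i) inferInstance)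
          (mem_Iio.2 n.lt_succ_self)) le_rfl
    exact hF.comp (Measurable.prodMk (ih.mono hle le_rfl) hn)

theorem indepFun_randomOrbit (hF : Measurable (Function.uncurry F)) (x : M) (n : ℕ) :
    IndepFun (fun w => randomOrbit F w x n) (fun w : ℕ → X => w n) (noiseLaw θ) := by
  have hind : iIndepFun (fun (i : ℕ) (w : ℕ → X) => w i) (noiseLaw θ) :=
    iIndepFun_infinitePi (X := fun _ w => w) fun _ => measurable_id
  have hpast : Indep (pastNoise X n) (⨆ i ∈ ({n} : Set ℕ),
      MeasurableSpace.comap (fun w : ℕ → X => w i) inferInstance) (noiseLaw θ) :=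
    indep_iSup_of_disjoint (fun i => (measurable_pi_apply i).comap_le) hind (by simp)
  rw [iSup_singleton] at hpast
  exact indep_of_indep_of_le_left hpast (measurable_pastNoise_randomOrbit hF x n).comap_le

theorem map_randomOrbit (hF : Measurable (Function.uncurry F)) (x : M) (n : ℕ) :
    (noiseLaw θ).map (fun w => randomOrbit F w x n) = (transition F θ hF ^ n) x := by
  have hm (k : ℕ) : Measurable fun w : ℕ → X => randomOrbit F w x k :=
    (measurable_randomOrbit hF k).comp measurable_prodMk_left
  induction n with
  | zero =>
    rw [pow_zero]
    exact (Measure.map_const _ _).trans (by rw [measure_univ, one_smul]; rfl)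
  | succ n ih =>
    have hpair : (noiseLaw θ).map (fun w => (randomOrbit F w x n, w n)) =
        ((transition F θ hF ^ n) x).prod θ := by
      rw [(indepFun_randomOrbit hF x n).map_prod_eq_prod_map_map (hm n).aemeasurable
        (measurable_pi_apply n).aemeasurable, ih]
      congr 1
      exact Measure.infinitePi_map_eval (fun _ => θ) n
    rw [add_comm n 1, Kernel.pow_add, pow_one, Kernel.comp_apply, ← map_prod_eq_bind_transition,
      ← hpair, Measure.map_map hF ((hm n).prodMk (measurable_pi_apply n)), add_comm 1 n]
    rfl

theorem measurePreserving_randomOrbit (hF : Measurable (Function.uncurry F)) {μ : Measure M}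
    [SFinite μ] (hμ : (transition F θ hF).Invariant μ) (n : ℕ) :
    MeasurePreserving (fun z : M × (ℕ → X) => randomOrbit F z.2 z.1 n)
      (μ.prod (noiseLaw θ)) μ :=
  ⟨measurable_randomOrbit hF n, (map_prod_eq_bind (measurable_randomOrbit hF n)
    fun x => map_randomOrbit hF x n).trans (invariant_pow hμ n)⟩

end Orbit

section Density

theorem IsNormalizedVolume.isOpenPosMeasure {d : ℕ} {M : Type*} [TopologicalSpace M]
    [MeasurableSpace M] [BorelSpace M] [ChartedSpace (EuclideanSpace ℝ (Fin d)) M]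
    [IsManifold (𝓡 d) ∞ M] {Leb : Measure M} (h : IsNormalizedVolume (n := d) Leb) :
    Leb.IsOpenPosMeasure := by
  refine ⟨fun U hU ⟨x, hx⟩ => ?_⟩
  let e := chartAt (EuclideanSpace ℝ (Fin d)) x
  obtain ⟨r, hr, hrpos, hdensity⟩ := h.density e (IsManifold.chart_mem_maximalAtlas x)
  let V := U ∩ e.source
  have hV : IsOpen V := hU.inter e.open_source
  have heV : IsOpen (e '' V) := e.isOpen_image_of_subset_source hV inter_subset_right
  have hsub : e '' V ⊆ e.target := (e.mapsTo.mono_left inter_subset_right).image_subset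
  have hr' : AEMeasurable (fun y => ENNReal.ofReal (r y)) (volume.restrict (e '' V)) :=
    ((hr.continuousOn.mono hsub).aemeasurable heV.measurableSet).ennreal_ofReal
  intro hU0
  have hint := hdensity V hV.measurableSet inter_subset_right
  rw [measure_mono_null inter_subset_left hU0, eq_comm,
    setLIntegral_eq_zero_iff' heV.measurableSet hr'] at hint
  refine (heV.measure_pos volume ⟨e x, x, ⟨hx, mem_chart_source _ x⟩, rfl⟩).ne' ?_
  rw [measure_eq_zero_iff_ae_notMem]
  filter_upwards [hint] with y hy hyV
  exact (ENNReal.ofReal_pos.2 (hrpos y (hsub hyV))).ne' (hy hyV)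

theorem withDensity_le_smul {M : Type*} [TopologicalSpace M] [HereditarilyLindelofSpace M]
    [MeasurableSpace M] [OpensMeasurableSpace M] {m : Measure M} {q : M → ℝ≥0∞}
    (hq : Measurable q) {K : ℝ≥0∞} (h : ∀ᵐ y ∂m, y ∈ (m.withDensity q).support → q y ≤ K) :
    m.withDensity q ≤ K • m := by
  have hzero : ∀ᵐ y ∂m, y ∉ (m.withDensity q).support → q y = 0 := by
    have hms : MeasurableSet (m.withDensity q).supportᶜ :=
      Measure.isOpen_compl_support.measurableSet
    have hint : ∫⁻ y in (m.withDensity q).supportᶜ, q y ∂m = 0 := by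
      rw [← withDensity_apply _ hms, Measure.measure_compl_support]
    exact (setLIntegral_eq_zero_iff hms hq).1 hint
  rw [← withDensity_const]
  refine withDensity_mono ?_
  filter_upwards [h, hzero] with y hK h0
  by_cases hy : y ∈ (m.withDensity q).support
  · exact hK hy
  · exact (h0 hy).le.trans zero_le

theorem smul_restrict_le_withDensity {M : Type*} [MeasurableSpace M] {m : Measure M}
    {q : M → ℝ≥0∞} {B : Set M} (hB : MeasurableSet B) {k : ℝ≥0∞} (h : ∀ᵐ y ∂m, y ∈ B → k ≤ q y) :
    k • m.restrict B ≤ m.withDensity q := by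
  rw [← withDensity_const, ← withDensity_indicator hB]
  refine withDensity_mono (h.mono fun y hy => ?_)
  by_cases hyB : y ∈ B
  · rw [indicator_of_mem hyB]; exact hy hyB
  · rw [indicator_of_notMem hyB]; exact zero_le

end Density

section Perturbation

variable {M X : Type*} [MetricSpace M] [MeasurableSpace M] [BorelSpace M] [MetricSpace X]
  [MeasurableSpace X] {m : Measure M} {f : M → M} {F : M → X → M} {θ : Measure X}

theorem IsRandomPerturbation.exists_map_le_smul [SecondCountableTopology M]
    (h : IsRandomPerturbation m f F θ) : ∃ K : ℝ≥0, ∀ᵐ x ∂m, θ.map (F x) ≤ K • m := by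
  obtain ⟨_, K, -, -, hnoise⟩ := h.noise
  refine ⟨K.toNNReal, ?_⟩
  filter_upwards [hnoise] with x ⟨q, hq, hmap, hbound⟩
  rw [hmap] at hbound ⊢
  exact withDensity_le_smul hq (hbound.mono fun y hy hys => (hy hys).2)

theorem IsRandomPerturbation.exists_smul_restrict_ball_le (h : IsRandomPerturbation m f F θ) :
    ∃ ρ : ℝ, 0 < ρ ∧ ∃ q : ℝ≥0∞, q ≠ 0 ∧
      ∀ᵐ x ∂m, q • m.restrict (Metric.ball (f x) ρ) ≤ θ.map (F x) := by
  obtain ⟨ρ, hρ, hcov⟩ := h.covering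
  obtain ⟨k, _, hk, -, hnoise⟩ := h.noise
  refine ⟨ρ, hρ, ENNReal.ofReal k, (ENNReal.ofReal_pos.2 hk).ne', ?_⟩
  filter_upwards [hnoise, hcov] with x ⟨q, _, hmap, hbound⟩ hx
  refine (smul_restrict_le_withDensity Metric.isOpen_ball.measurableSet ?_).trans_eq hmap.symm
  exact hbound.mono fun y hy hyb => (hy (hx hyb)).1

end Perturbation

section Correlations

variable {M X : Type*} [MeasurableSpace M] [MeasurableSpace X] {F : M → X → M} {θ : Measure X}
  [IsProbabilityMeasure θ] {m μ ν : Measure M} {K : ℝ≥0} {φ ψ : M → ℝ}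

theorem integral_abs_le_of_le_smul (hν : ν ≤ K • m) (hψ : MemLp ψ 1 m) :
    ∫ x, |ψ x| ∂ν ≤ K * lpNorm ψ 1 m := by
  rw [lpNorm_one_eq_integral_norm hψ.1]
  refine (integral_mono_measure hν (.of_forall fun _ => abs_nonneg _)
    (memLp_one_iff_integrable.1 hψ).abs.smul_measure_nnreal).trans_eq ?_
  rw [integral_smul_nnreal_measure]
  rfl

/-- The annealed covariance, that is, the annealed correlation before normalisation by the norms
of the observables. -/
def annealedCov (F : M → X → M) (θ : Measure X) (μ : Measure M) (φ ψ : M → ℝ) (n : ℕ) : ℝ :=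
  ∫ x, (∫ w, ψ (randomOrbit F w x n) ∂(noiseLaw θ)) * φ x ∂μ - (∫ x, φ x ∂μ) * ∫ x, ψ x ∂μ

theorem annealedCov_zero : annealedCov F θ μ φ ψ 0 = annealedCov F θ μ ψ φ 0 := by
  simp only [annealedCov, randomOrbit, integral_const, probReal_univ, one_smul, mul_comm]

variable {hF : Measurable (Function.uncurry F)}

theorem ae_integral_randomOrbit (hμ : (transition F θ hF).Invariant μ) (hψ : Integrable ψ μ)
    (n : ℕ) : ∀ᵐ x ∂μ, ∫ w, ψ (randomOrbit F w x n) ∂(noiseLaw θ) =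
      ∫ y, ψ y ∂((transition F θ hF ^ n) x) := by
  rw [← (invariant_pow hμ n).def] at hψ
  filter_upwards [Measure.ae_integrable_of_integrable_comp hψ] with x hx
  rw [← map_randomOrbit] at hx ⊢
  have hm := (measurable_randomOrbit hF n).comp (measurable_prodMk_left (x := x))
  exact (integral_map hm.aemeasurable hx.1).symm

theorem abs_annealedCov_le (hμ : (transition F θ hF).Invariant μ) (hφ : Integrable φ μ)
    (hψ : Integrable ψ μ) {n : ℕ} {E : ℝ}
    (hE : ∀ᵐ x ∂μ, |∫ y, ψ y ∂((transition F θ hF ^ n) x) - ∫ y, ψ y ∂μ| ≤ E) :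
    |annealedCov F θ μ φ ψ n| ≤ E * ∫ x, |φ x| ∂μ := by
  let D (x : M) : ℝ := ∫ y, ψ y ∂((transition F θ hF ^ n) x) - ∫ y, ψ y ∂μ
  have hDm : AEStronglyMeasurable D μ := by
    have hψ' := hψ
    rw [← (invariant_pow hμ n).def] at hψ'
    exact (integrable_integral_of_bind hψ').1.sub aestronglyMeasurable_const
  have hDφ : Integrable (fun x => D x * φ x) μ := hφ.bdd_mul hDm hE
  have hcov : annealedCov F θ μ φ ψ n = ∫ x, D x * φ x ∂μ := by
    rw [annealedCov, sub_eq_iff_eq_add, mul_comm (∫ x, φ x ∂μ), ← integral_const_mul,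
      ← integral_add hDφ (hφ.const_mul _)]
    refine integral_congr_ae ?_
    filter_upwards [ae_integral_randomOrbit hμ hψ n] with x hx
    rw [hx, ← add_mul, sub_add_cancel]
  rw [hcov, ← integral_const_mul]
  refine abs_integral_le_integral_abs.trans (integral_mono_ae hDφ.abs (hφ.abs.const_mul E) ?_)
  filter_upwards [hE] with x hx
  rw [abs_mul]
  gcongr

section UniformlyErgodic

variable {A Λ : ℝ}

theorem abs_annealedCov_le_lpNorm_one_mul_lpNorm_top (hμ : (transition F θ hF).Invariant μ)
    (hμK : μ ≤ K • m) (h : IsUniformlyErgodic m (transition F θ hF) μ A Λ) (hA : 0 ≤ A)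
    (hΛ : 0 ≤ Λ) [IsFiniteMeasure μ] (hφ : MemLp φ 1 m) (hψ : MemLp ψ ⊤ m) (n : ℕ) :
    |annealedCov F θ μ φ ψ n| ≤ lpNorm φ 1 m * lpNorm ψ ⊤ m * (K * A * (Λ ^ n)⁻¹) := by
  have hμm : μ ≪ m := Measure.absolutelyContinuous_of_le_smul hμK
  have hgap := h hψ.1.aemeasurable (ae_le_lpNorm_exponent_top hψ) n
  calc |annealedCov F θ μ φ ψ n| ≤ A * lpNorm ψ ⊤ m * (Λ ^ n)⁻¹ * ∫ x, |φ x| ∂μ :=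
        abs_annealedCov_le hμ ((hφ.of_measure_le_smul ENNReal.coe_ne_top hμK).integrable le_rfl)
          ((hψ.of_measure_le_smul ENNReal.coe_ne_top hμK).integrable le_top) (hμm.ae_le hgap)
    _ ≤ A * lpNorm ψ ⊤ m * (Λ ^ n)⁻¹ * (K * lpNorm φ 1 m) := by
        gcongr
        · exact mul_nonneg (mul_nonneg hA lpNorm_nonneg) (by positivity)
        · exact integral_abs_le_of_le_smul hμK hφ
    _ = lpNorm φ 1 m * lpNorm ψ ⊤ m * (K * A * (Λ ^ n)⁻¹) := by ring

/-- One step of the noise turns an observable in `L¹` into a bounded one. -/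
theorem ae_abs_integral_pow_succ_sub_le [IsFiniteMeasure m]
    (hκ : ∀ᵐ x ∂m, transition F θ hF x ≤ K • m) (hμ : (transition F θ hF).Invariant μ)
    (hμK : μ ≤ K • m) (h : IsUniformlyErgodic m (transition F θ hF) μ A Λ) (hψ : MemLp ψ 1 m)
    (n : ℕ) :
    ∀ᵐ x ∂μ, |∫ y, ψ y ∂((transition F θ hF ^ (n + 1)) x) - ∫ y, ψ y ∂μ| ≤
      A * (K * lpNorm ψ 1 m) * (Λ ^ n)⁻¹ := by
  have hμm : μ ≪ m := Measure.absolutelyContinuous_of_le_smul hμK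
  have hψμ : Integrable ψ μ :=
    (memLp_one_iff_integrable.1 hψ).of_measure_le_smul ENNReal.coe_ne_top hμK
  have hbound : ∀ᵐ x ∂m, |∫ y, ψ y ∂(transition F θ hF x)| ≤ K * lpNorm ψ 1 m :=
    hκ.mono fun x hx => abs_integral_le_integral_abs.trans (integral_abs_le_of_le_smul hx hψ)
  have hmean : ∫ x, ∫ y, ψ y ∂(transition F θ hF x) ∂μ = ∫ y, ψ y ∂μ := by
    rw [← integral_bind (by rwa [hμ.def]), hμ.def]
  have hstep := ae_integral_pow_add n 1 (by rwa [(invariant_pow hμ (n + 1)).def])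
  have hmeas : AEMeasurable (fun x => ∫ y, ψ y ∂(transition F θ hF x)) m := by
    refine (integrable_integral_of_bind ?_).aemeasurable
    refine (memLp_one_iff_integrable.1 hψ).of_measure_le_smul (c := m univ * K)
      (ENNReal.mul_ne_top (measure_ne_top m univ) ENNReal.coe_ne_top) ?_
    rw [mul_smul]
    exact bind_le_measure_univ_smul hκ
  filter_upwards [hμm.ae_le (h hmeas hbound n), hstep] with x hx hxn
  rw [pow_one] at hxn
  rwa [hxn, ← hmean]

theorem abs_annealedCov_le_lpNorm_top_mul_lpNorm_one
    (hκ : ∀ᵐ x ∂m, transition F θ hF x ≤ K • m) (hμ : (transition F θ hF).Invariant μ)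
    (hμK : μ ≤ K • m) (h : IsUniformlyErgodic m (transition F θ hF) μ A Λ) (hA : 0 ≤ A)
    (hΛ : 1 ≤ Λ) [IsFiniteMeasure m] [IsProbabilityMeasure μ] (hφ : MemLp φ ⊤ m)
    (hψ : MemLp ψ 1 m) (n : ℕ) :
    |annealedCov F θ μ φ ψ n| ≤ lpNorm φ ⊤ m * lpNorm ψ 1 m * (K * A * Λ * (Λ ^ n)⁻¹) := by
  have hφμ : MemLp φ ⊤ μ := hφ.of_measure_le_smul ENNReal.coe_ne_top hμK
  cases n with
  | zero =>
    rw [annealedCov_zero, mul_comm (lpNorm φ ⊤ m)]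
    refine (abs_annealedCov_le_lpNorm_one_mul_lpNorm_top hμ hμK h hA (zero_le_one.trans hΛ)
      hψ hφ 0).trans ?_
    rw [pow_zero, inv_one, mul_one, mul_one]
    refine mul_le_mul_of_nonneg_left ?_ (mul_nonneg lpNorm_nonneg lpNorm_nonneg)
    exact le_mul_of_one_le_right (by positivity) hΛ
  | succ n =>
    have hφ1 : ∫ x, |φ x| ∂μ ≤ lpNorm φ ⊤ m :=
      (integral_mem_Icc (hφμ.integrable le_top).abs
        ((Measure.absolutelyContinuous_of_le_smul hμK).ae_le ((ae_le_lpNorm_exponent_top hφ).mono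
          fun x hx => ⟨abs_nonneg (φ x), hx⟩))).2
    calc |annealedCov F θ μ φ ψ (n + 1)|
        ≤ A * (K * lpNorm ψ 1 m) * (Λ ^ n)⁻¹ * ∫ x, |φ x| ∂μ :=
          abs_annealedCov_le hμ (hφμ.integrable le_top)
            ((hψ.of_measure_le_smul ENNReal.coe_ne_top hμK).integrable le_rfl)
            (ae_abs_integral_pow_succ_sub_le hκ hμ hμK h hψ n)
      _ ≤ A * (K * lpNorm ψ 1 m) * (Λ ^ n)⁻¹ * lpNorm φ ⊤ m := by
          have := lpNorm_nonneg (f := ψ) (p := 1) (μ := m)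
          gcongr
      _ = lpNorm φ ⊤ m * lpNorm ψ 1 m * (K * A * Λ * (Λ ^ (n + 1))⁻¹) := by
          field_simp
          ring

end UniformlyErgodic

theorem hasExpDecay_of_abs_annealedCov_le [IsFiniteMeasure μ]
    (hF : Measurable (Function.uncurry F)) (hμ : (transition F θ hF).Invariant μ)
    (hμK : μ ≤ K • m) {p q : ℝ≥0∞} [hpq : p.HolderConjugate q] {C Λ : ℝ} (hC : 0 < C) (hΛ : 1 < Λ)
    (hcov : ∀ φ ψ : M → ℝ, MemLp φ p m → MemLp ψ q m → ∀ n,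
      |annealedCov F θ μ φ ψ n| ≤ lpNorm φ p m * lpNorm ψ q m * (C * (Λ ^ n)⁻¹)) :
    HasExpDecay m F θ μ p q := by
  refine ⟨C, Λ, hC, hΛ, fun φ ψ hφ hψ => ?_⟩
  have hφμ : MemLp φ p μ := hφ.of_measure_le_smul ENNReal.coe_ne_top hμK
  have hψμ : MemLp ψ q μ := hψ.of_measure_le_smul ENNReal.coe_ne_top hμK
  have : q.HolderConjugate p := hpq.symm
  refine ⟨hφμ.integrable (ENNReal.HolderConjugate.one_le p q),
    hψμ.integrable (ENNReal.HolderConjugate.one_le q p), fun n => ⟨?_, ?_⟩⟩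
  · exact (hψμ.comp_measurePreserving (measurePreserving_randomOrbit hF hμ n)).integrable_mul
      (hφμ.comp_measurePreserving measurePreserving_fst)
  · rw [annealedCor, toReal_eLpNorm hφ.1, toReal_eLpNorm hψ.1]
    exact inv_mul_le_of_le_mul₀ (mul_nonneg lpNorm_nonneg lpNorm_nonneg) (by positivity)
      (hcov φ ψ hφ hψ n)

theorem pos_of_le_smul [NeZero μ] (hμK : μ ≤ K • m) : 0 < K := by
  refine pos_iff_ne_zero.2 fun hK => NeZero.ne μ (Measure.nonpos_iff_eq_zero'.1 ?_)
  rwa [hK, zero_smul] at hμK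

theorem hasExpDecay_one_top [IsProbabilityMeasure μ] (hF : Measurable (Function.uncurry F))
    (hμ : (transition F θ hF).Invariant μ) (hμK : μ ≤ K • m) {A Λ : ℝ} (hA : 0 < A) (hΛ : 1 < Λ)
    (h : IsUniformlyErgodic m (transition F θ hF) μ A Λ) : HasExpDecay m F θ μ 1 ⊤ :=
  have hK := pos_of_le_smul hμK
  hasExpDecay_of_abs_annealedCov_le hF hμ hμK (by positivity) hΛ fun _ _ hφ hψ =>
    abs_annealedCov_le_lpNorm_one_mul_lpNorm_top hμ hμK h hA.le (by positivity) hφ hψ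

theorem hasExpDecay_top_one [IsFiniteMeasure m] [IsProbabilityMeasure μ]
    (hF : Measurable (Function.uncurry F)) (hκ : ∀ᵐ x ∂m, transition F θ hF x ≤ K • m)
    (hμ : (transition F θ hF).Invariant μ) (hμK : μ ≤ K • m) {A Λ : ℝ} (hA : 0 < A) (hΛ : 1 < Λ)
    (h : IsUniformlyErgodic m (transition F θ hF) μ A Λ) : HasExpDecay m F θ μ ⊤ 1 :=
  have hK := pos_of_le_smul hμK
  hasExpDecay_of_abs_annealedCov_le hF hμ hμK (by positivity) hΛ fun _ _ hφ hψ =>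
    abs_annealedCov_le_lpNorm_top_mul_lpNorm_one hκ hμ hμK h hA.le hΛ.le hφ hψ

end Correlations

end RandomPert

end

theorem theoremA_general {M : Type*} [MetricSpace M] [CompactSpace M] [PreconnectedSpace M]
    [MeasurableSpace M] [BorelSpace M] (m : Measure M) [IsProbabilityMeasure m]
    [m.IsOpenPosMeasure] (f : M → M) (x₀ : M)
    (hdense : Dense {y : M | ∃ n : ℕ, 1 ≤ n ∧ f^[n] x₀ = y})
    (hcont : ∀ n : ℕ, 1 ≤ n → ContinuousAt f (f^[n] x₀))
    {X : Type*} [MeasurableSpace X] (F : M → X → M) (hF : Measurable (Function.uncurry F))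
    (θ : Measure X) [IsProbabilityMeasure θ]
    (hup : ∃ K : NNReal, ∀ᵐ x ∂m, θ.map (F x) ≤ K • m)
    (hlow : ∃ ρ : ℝ, 0 < ρ ∧ ∃ q : ℝ≥0∞, q ≠ 0 ∧
      ∀ᵐ x ∂m, q • m.restrict (Metric.ball (f x) ρ) ≤ θ.map (F x)) :
    ∃ μ : Measure M, RandomPert.IsStationary F θ μ ∧ μ ≪ m ∧
      (∀ ν : Measure M, RandomPert.IsStationary F θ ν → ν ≪ m → ν = μ) ∧
      RandomPert.HasExpDecay m F θ μ ⊤ 1 ∧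
      RandomPert.HasExpDecay m F θ μ 1 ⊤ := by
  obtain ⟨K, hK⟩ := hup
  obtain ⟨ρ, hρ, q, hq, hball⟩ := hlow
  let κ := RandomPert.transition F θ hF
  have hbind {ν : Measure M} [IsProbabilityMeasure ν] (hν : ν ≪ m) : ν.bind κ ≤ K • m := by
    simpa using RandomPert.bind_le_measure_univ_smul (κ := κ) (hν.ae_le hK)
  have hκm : m.bind κ ≪ m := Measure.absolutelyContinuous_of_le_smul (hbind .rfl)
  have horbit : DenseRange fun n => f^[n] (f x₀) := by
    refine hdense.mono ?_
    rintro _ ⟨n, hn, rfl⟩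
    exact ⟨n - 1, by simp only [← Function.iterate_succ_apply, Nat.succ_eq_add_one,
      Nat.sub_add_cancel hn]⟩
  obtain ⟨N, hN, c, hc, hc1, hdoeblin⟩ := RandomPert.exists_isDoeblin_pow horbit
    (fun n => hcont (n + 1) (Nat.le_add_left 1 n)) hρ hq (κ := κ) hball hκm
  obtain ⟨μ, _, hμm, hμ⟩ := RandomPert.exists_invariant_of_isDoeblin_pow hκm hdoeblin hc
  have hμK : μ ≤ K • m := hμ.def ▸ hbind hμm
  obtain ⟨A, Λ, hA, hΛ, herg⟩ :=
    RandomPert.exists_isUniformlyErgodic hκm hN hdoeblin hc hc1 hμ hμm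
  refine ⟨μ, (RandomPert.isStationary_iff hF).2 ⟨‹_›, hμ⟩, hμm, fun ν hν hνm => ?_,
    RandomPert.hasExpDecay_top_one hF hK hμ hμK hA hΛ herg,
    RandomPert.hasExpDecay_one_top hF hμ hμK hA hΛ herg⟩
  obtain ⟨_, hνinv⟩ := (RandomPert.isStationary_iff hF).1 hν
  exact hdoeblin.eq_of_invariant hc (RandomPert.invariant_pow hνinv N) hνm
    (RandomPert.invariant_pow hμ N) hμm

theorem theoremA {d : ℕ} {M : Type*} [MetricSpace M] [CompactSpace M] [ConnectedSpace M]
    [ChartedSpace (EuclideanSpace ℝ (Fin d)) M] [IsManifold (𝓡 d) ∞ M]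
    [Bundle.RiemannianBundle (fun x : M => TangentSpace (𝓡 d) x)]
    [IsContMDiffRiemannianBundle (𝓡 d) ∞ (EuclideanSpace ℝ (Fin d))
      (fun x : M => TangentSpace (𝓡 d) x)]
    [IsRiemannianManifold (𝓡 d) M] [MeasurableSpace M] [BorelSpace M]
    (Leb : Measure M) (hLeb : RandomPert.IsNormalizedVolume (n := d) Leb)
    (f : M → M) (hf : Measurable f) (hfc : ∀ᵐ x ∂Leb, ContinuousAt f x)
    (x₀ : M) (hdense : Dense {y : M | ∃ n : ℕ, 1 ≤ n ∧ f^[n] x₀ = y})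
    (hcont : ∀ n : ℕ, 1 ≤ n → ContinuousAt f (f^[n] x₀))
    {X : Type*} [MetricSpace X] [CompactSpace X] [MeasurableSpace X] [BorelSpace X]
    (F : M → X → M) (θ : Measure X) (hF : RandomPert.IsRandomPerturbation Leb f F θ) :
    ∃ μ : Measure M, RandomPert.IsStationary F θ μ ∧ μ ≪ Leb ∧
      (∀ ν : Measure M, RandomPert.IsStationary F θ ν → ν ≪ Leb → ν = μ) ∧
      RandomPert.HasExpDecay Leb F θ μ ⊤ 1 ∧
      RandomPert.HasExpDecay Leb F θ μ 1 ⊤ := by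
  have := hLeb.isProbabilityMeasure
  have := hLeb.isOpenPosMeasure
  have := hF.isProbabilityMeasure
  exact theoremA_general Leb f x₀ hdense hcont F hF.measurable θ hF.exists_map_le_smul
    hF.exists_smul_restrict_ball_le
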